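/- **Theorem 3 (Longevity).** For $j\in\{0,\tfrac12,1,\tfrac32,\dots\}$ let $J_x,J_y,J_z$ be the angular momentum operators of a spin-$j$ system (dimension $2j+1$), the $z$-axis being the direction of the reference frame, and let $\zeta(X)=\frac1{j(j+1)}\sum_{k\in\{x,y,z\}}J_kXJ_k$. For every $j$ let $\rho^{(0)}=\rho^{(0)}_j$ be a density matrix of the spin-$j$ system (the initial state of the frame). Let $\chi=\chi_j$ be a completely positive trace-preserving map on the joint system formed by the spin-$j$ system and a finite-dimensional reservoir system that carries a unitary representation of $SU(2)$, let $\chi$ commute with all joint rotations, and let $\sigma=\sigma_j$ be a rotationally invariant state of the reservoir system. Using the frame once replaces its state $\rho$ by $\xi(\rho)=\mathrm{Tr}_r[\chi(\rho\otimes\sigma)]$; let $\rho^{(t)}=\xi^{\circ t}(\rho^{(0)})$. Suppose that $\xi=\sum_{n=0}^{2j}q_n(j)\,\zeta^{\circ n}$ with real coefficients $q_n(j)$, fix an integer $\ell\ge1$, and assume: 1. there is $n_{max}$, independent of $j$, with $q_n(j)=0$ for all $n\ge n_{max}$ and all $j$; 2. for each $n$, $q_n(j)$ is, for all large $j$, a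 quotient of two real polynomials in $j$, the degree of the denominator being at least that of the numerator (so $q_n=O(1)$); 3. the initial $\ell$-th moment is of order $j^\ell$: there is $a>0$, independent of $j$, with $\mathrm{Tr}[\rho^{(0)}J_z^\ell]\ge a\,j^\ell$ for all large $j$ (the bound $\mathrm{Tr}[\rho^{(0)}J_z^\ell]\le j^\ell$ always holds). For a threshold $\theta\in\mathbb R$ let $T_j(\theta)$ be the least $t\ge0$ with $\mathrm{Tr}[\rho^{(t)}J_z^\ell]<\theta$ ($T_j(\theta)=\infty$ if there is none). Then $T_j(\theta)$ scales as $j^2$ for thresholds that are a fixed fraction of $j^\ell$, in the following sense: * (lower bound) for every $c<a$ there is $C>0$ such that for all large $j$ and all $\theta\le c\,j^\ell$ (in particular for any threshold that does not depend on $j$, when $c>0$) one has $T_j(\theta)\ge C j^2$; * (upper bound) if the disturbance does not fade away as $j\to\infty$, i.e. $q_n(j)\not\to0$ for some $n\ge1$, then for every $c>0$, with $c>\frac1{\ell+1}$ when $\ell$ is even, there is $C>0$ such that for all large $j$ and all $\theta\ge c\,j^\ell$ one has $T_j(\theta)\le C j^2$. -/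

import Mathlib

open Matrix Filter
open scoped Matrix Kronecker ComplexOrder ENNReal

noncomputable section

namespace SpinFrame

/-! ### Angular momentum on a spin-`j` system

Spins are indexed by `N = 2 j : ℕ`, so that all integer and half-integer values `j = N / 2` occur.
The Hilbert space is `ℂ ^ (N + 1)`; its standard basis is the eigenbasis of the angular momentum
along the direction of the frame (the `z`-axis), the `i`-th vector having magnetic
number `m = i - j`. -/

/-- The spin `j = N / 2`. -/
def spin (N : ℕ) : ℝ := (N : ℝ) / 2

/-- The magnetic number `m = i - j ∈ {-j, …, j}` of the `i`-th basis vector. -/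
def mag (N : ℕ) (i : Fin (N + 1)) : ℝ := (i : ℕ) - spin N

/-- The raising operator `J₊ |m⟩ = √(j (j + 1) - m (m + 1)) |m + 1⟩`. -/
def Jplus (N : ℕ) : Matrix (Fin (N + 1)) (Fin (N + 1)) ℂ :=
  Matrix.of fun a b =>
    if (a : ℕ) = (b : ℕ) + 1 then
      ((Real.sqrt (spin N * (spin N + 1) - mag N b * (mag N b + 1)) : ℝ) : ℂ)
    else 0

/-- `J_x = (J₊ + J₋) / 2`. -/
def Jx (N : ℕ) : Matrix (Fin (N + 1)) (Fin (N + 1)) ℂ :=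
  (1 / 2 : ℂ) • (Jplus N + (Jplus N)ᴴ)

/-- `J_y = (J₊ - J₋) / (2 i)`. -/
def Jy (N : ℕ) : Matrix (Fin (N + 1)) (Fin (N + 1)) ℂ :=
  (1 / (2 * Complex.I) : ℂ) • (Jplus N - (Jplus N)ᴴ)

/-- `J_z |m⟩ = m |m⟩`. -/
def Jz (N : ℕ) : Matrix (Fin (N + 1)) (Fin (N + 1)) ℂ :=
  Matrix.diagonal fun i => ((mag N i : ℝ) : ℂ)

/-- The triple `(J_x, J_y, J_z)`. -/
def J (N : ℕ) : Fin 3 → Matrix (Fin (N + 1)) (Fin (N + 1)) ℂ := ![Jx N, Jy N, Jz N]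

/-- The map `ζ(X) = (1 / (j (j + 1))) ∑ₖ Jₖ X Jₖ`. -/
def zeta (N : ℕ) (X : Matrix (Fin (N + 1)) (Fin (N + 1)) ℂ) :
    Matrix (Fin (N + 1)) (Fin (N + 1)) ℂ :=
  ((1 / (spin N * (spin N + 1)) : ℝ) : ℂ) • ∑ k : Fin 3, J N k * X * J N k

/-! ### States, channels, rotations -/

/-- Density matrices. -/
def IsState {n : Type*} [Fintype n] (ρ : Matrix n n ℂ) : Prop :=
  ρ.PosSemidef ∧ ρ.trace = 1

/-- The map `Φ ⊗ id` on `n × k` matrices. -/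
def ampliation {n k : Type*} (Φ : Matrix n n ℂ →ₗ[ℂ] Matrix n n ℂ)
    (M : Matrix (n × k) (n × k) ℂ) : Matrix (n × k) (n × k) ℂ :=
  Matrix.of fun p q => Φ (Matrix.of fun a b => M (a, p.2) (b, q.2)) p.1 q.1

/-- Quantum channels: completely positive, trace-preserving maps. -/
def IsChannel {n : Type*} [Fintype n] (Φ : Matrix n n ℂ →ₗ[ℂ] Matrix n n ℂ) : Prop :=
  (∀ (k : ℕ) (M : Matrix (n × Fin k) (n × Fin k) ℂ),
      M.PosSemidef → (ampliation Φ M).PosSemidef) ∧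
    ∀ X, (Φ X).trace = X.trace

/-- Three Hermitian matrices with the commutation relations `[K_x, K_y] = i K_z` and its cyclic
permutations, that is, the generators of a unitary representation of `SU(2)`. -/
def IsSpinTriple {n : Type*} [Fintype n] (K : Fin 3 → Matrix n n ℂ) : Prop :=
  (∀ a, (K a).IsHermitian) ∧
    ∀ a, K a * K (a + 1) - K (a + 1) * K a = Complex.I • K (a + 2)

/-- The unitary `exp(-i (v ⋅ K))` that represents the rotation about `v ∈ ℝ³` by the angle `‖v‖`
(every element of `SU(2)` is obtained from some `v`). -/
def rotation {n : Type*} [Fintype n] [DecidableEq n] (K : Fin 3 → Matrix n n ℂ)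
    (v : Fin 3 → ℝ) : Matrix n n ℂ :=
  NormedSpace.exp ((-Complex.I) • ∑ a, ((v a : ℝ) : ℂ) • K a)

/-- The generators `J ⊗ 1 + 1 ⊗ K` of the joint rotations of the frame and the reservoir system. -/
def jointSpin (N : ℕ) {r : Type*} [DecidableEq r] (K : Fin 3 → Matrix r r ℂ) :
    Fin 3 → Matrix (Fin (N + 1) × r) (Fin (N + 1) × r) ℂ :=
  fun a => J N a ⊗ₖ (1 : Matrix r r ℂ) + (1 : Matrix (Fin (N + 1)) (Fin (N + 1)) ℂ) ⊗ₖ K a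

/-- The partial trace over the second factor. -/
def traceRight {m r : Type*} [Fintype r] (X : Matrix (m × r) (m × r) ℂ) : Matrix m m ℂ :=
  Matrix.of fun a b => ∑ i, X (a, i) (b, i)

/-! ### Using the frame -/

/-- A rotationally invariant joint operation on a spin-`N/2` frame and one system of a reservoir:
a finite-dimensional system that carries a unitary representation of `SU(2)`, a rotationally
invariant state `σ` of it, and a channel `χ` on the joint system that commutes with all joint
rotations. -/
structure JointOperation (N : ℕ) where
  /-- dimension of the reservoir system -/
  dim : ℕ
  /-- angular momentum of the reservoir system -/
  K : Fin 3 → Matrix (Fin dim) (Fin dim) ℂ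
  isSpinTriple : IsSpinTriple K
  /-- state of the reservoir system -/
  σ : Matrix (Fin dim) (Fin dim) ℂ
  isState : IsState σ
  σ_invariant : ∀ v, rotation K v * σ * (rotation K v)ᴴ = σ
  /-- the joint operation -/
  χ : Matrix (Fin (N + 1) × Fin dim) (Fin (N + 1) × Fin dim) ℂ →ₗ[ℂ]
    Matrix (Fin (N + 1) × Fin dim) (Fin (N + 1) × Fin dim) ℂ
  isChannel : IsChannel χ
  χ_invariant : ∀ v X,
    χ (rotation (jointSpin N K) v * X * (rotation (jointSpin N K) v)ᴴ) =
      rotation (jointSpin N K) v * χ X * (rotation (jointSpin N K) v)ᴴ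

/-- The disturbance map `ξ(ρ) = Tr_r[χ(ρ ⊗ σ)]`. -/
def JointOperation.disturbance {N : ℕ} (E : JointOperation N)
    (ρ : Matrix (Fin (N + 1)) (Fin (N + 1)) ℂ) : Matrix (Fin (N + 1)) (Fin (N + 1)) ℂ :=
  traceRight (E.χ (ρ ⊗ₖ E.σ))

/-- The state of the frame after `t` uses. -/
def JointOperation.stateAfter {N : ℕ} (E : JointOperation N)
    (ρ : Matrix (Fin (N + 1)) (Fin (N + 1)) ℂ) (t : ℕ) :
    Matrix (Fin (N + 1)) (Fin (N + 1)) ℂ :=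
  E.disturbance^[t] ρ

/-- The `ℓ`-th moment `Tr[ρ J_z ^ ℓ]` (a real number for Hermitian `ρ`). -/
def moment (N ℓ : ℕ) (ρ : Matrix (Fin (N + 1)) (Fin (N + 1)) ℂ) : ℝ :=
  ((ρ * Jz N ^ ℓ).trace).re

/-- The longevity: the least number `t` of uses after which the `ℓ`-th moment is below the
threshold `θ`, and `⊤` if this never happens. -/
def longevity {N : ℕ} (E : JointOperation N) (ρ : Matrix (Fin (N + 1)) (Fin (N + 1)) ℂ)
    (ℓ : ℕ) (θ : ℝ) : ℕ∞ :=
  ⨅ (t : ℕ) (_ : moment N ℓ (E.stateAfter ρ t) < θ), (t : ℕ∞)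

/-- The functions of the spin (given by their values `f N` at `j = N / 2`) that for large `j` are a
quotient of two real polynomials in `j`, the degree of the denominator being at least that of the
numerator. -/
def IsBoundedRational (f : ℕ → ℝ) : Prop :=
  ∃ P D : Polynomial ℝ, D ≠ 0 ∧ P.degree ≤ D.degree ∧
    ∀ᶠ N : ℕ in atTop, f N = P.eval (spin N) / D.eval (spin N)

end SpinFrame

end

noncomputable section
namespace SpinFrame

/-! Only the diagonal of the state matters for a moment of `J_z`, and `ζ` maps diagonals to
diagonals. Dually it acts on functions of the magnetic number as a nearest-neighbour random walk on
the spectrum (`mean_zeta`). In the variable $x=m/j$ this walk is the identity plus $j^{-2}$ times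
the Legendre operator $\frac12\frac{d}{dx}(1-x^2)\frac{d}{dx}$, up to $O(j^{-3})$ on each power of
$x$ (`exists_walk_relPow_bound`). Its $n$-th iterate has $n$ times that correction. The coefficients
sum to 1 by trace preservation, so one use of the frame moves the $k$-th relative moment by $\mu
j^{-2}$ times the Legendre term, where $\mu=\sum_n n\,q_n$ (`exists_step_bound`).

Lower bound: $\mu$ stays bounded, so each use costs the $\ell$-th relative moment at most $L/j^2$,
and losing the fraction $a-c$ takes at least $(a-c)j^2/L$ uses.

Upper bound: the moment equations are triangular, the $k$-th being driven by the $(k-2)$-nd, and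
their stationary solution is the moments of the uniform law on $[-1,1]$. If $\mu$ has a positive
limit, every moment gets close to its stationary value within $O(j^2)$ uses
(`exists_relaxation_time`). Since the $q_n$ may be negative, positivity of the limit is a real
issue. It follows from positivity of `ξ`, tested on the equatorial state $m=0$ as $j\to\infty$
(`sum_mul_limit_pos`). -/

/-! ### Diagonals of matrices and the random walk dual to `ζ` -/

/-- The mean of the function `f` of `J_z` in the state `X`. -/
def mean {N : ℕ} (X : Matrix (Fin (N + 1)) (Fin (N + 1)) ℂ) (f : ℝ → ℝ) : ℝ :=
  ∑ i, (X i i).re * f (mag N i)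

/-- The action of `ζ` on functions of `J_z`. -/
def walk (N : ℕ) (f : ℝ → ℝ) (m : ℝ) : ℝ :=
  1 / (spin N * (spin N + 1)) *
    (m ^ 2 * f m + 1 / 2 * ((spin N * (spin N + 1) - m * (m + 1)) * f (m + 1)) +
      1 / 2 * ((spin N * (spin N + 1) - m * (m - 1)) * f (m - 1)))

lemma spin_nonneg (N : ℕ) : 0 ≤ spin N := by unfold spin; positivity

lemma abs_mag_le (N : ℕ) (i : Fin (N + 1)) : |mag N i| ≤ spin N := by
  have h : ((i : ℕ) : ℝ) ≤ N := by exact_mod_cast Nat.lt_succ_iff.1 i.2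
  have h0 : (0 : ℝ) ≤ ((i : ℕ) : ℝ) := by positivity
  rw [abs_le]
  unfold mag spin
  constructor <;> linarith

lemma raising_coeff_nonneg {j m : ℝ} (h : |m| ≤ j) : 0 ≤ j * (j + 1) - m * (m + 1) := by
  obtain ⟨h1, h2⟩ := abs_le.1 h
  nlinarith [mul_nonneg (sub_nonneg.2 h2) (by linarith : 0 ≤ j + m)]

lemma lowering_coeff_nonneg {j m : ℝ} (h : |m| ≤ j) : 0 ≤ j * (j + 1) - m * (m - 1) := by
  have := raising_coeff_nonneg (j := j) (m := -m) (by rwa [abs_neg])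
  linarith

lemma mag_of_succ {N : ℕ} {a b : Fin (N + 1)} (h : (a : ℕ) = (b : ℕ) + 1) :
    mag N a = mag N b + 1 := by
  unfold mag
  rw [h]
  push_cast
  ring

/-- Either there is a next basis vector, or the raising coefficient vanishes. -/
lemma exists_succ_or (N : ℕ) (b : Fin (N + 1)) :
    (∃ a : Fin (N + 1), (a : ℕ) = (b : ℕ) + 1) ∨
      ((∀ a : Fin (N + 1), (a : ℕ) ≠ (b : ℕ) + 1) ∧
        spin N * (spin N + 1) - mag N b * (mag N b + 1) = 0) := by
  by_cases h : (b : ℕ) + 1 < N + 1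
  · exact Or.inl ⟨⟨b + 1, h⟩, rfl⟩
  · have hb : (b : ℕ) = N := by omega
    refine Or.inr ⟨fun a ha => by omega, ?_⟩
    unfold mag spin
    rw [hb]
    ring

lemma exists_pred_or (N : ℕ) (b : Fin (N + 1)) :
    (∃ a : Fin (N + 1), (b : ℕ) = (a : ℕ) + 1) ∨
      ((∀ a : Fin (N + 1), (b : ℕ) ≠ (a : ℕ) + 1) ∧
        spin N * (spin N + 1) - mag N b * (mag N b - 1) = 0) := by
  by_cases h : (b : ℕ) = 0
  · refine Or.inr ⟨fun a ha => by omega, ?_⟩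
    unfold mag spin
    rw [h]
    push_cast
    ring
  · exact Or.inl ⟨⟨b - 1, by omega⟩, by simp; omega⟩

/-- The squares of the entries of `J₊`. -/
def hop (N : ℕ) (a b : Fin (N + 1)) : ℝ :=
  if (a : ℕ) = (b : ℕ) + 1 then spin N * (spin N + 1) - mag N b * (mag N b + 1) else 0

/-- At the top of the spectrum the value of `f` outside it is multiplied by a vanishing coefficient.
This allows functions on all of `ℝ`, with no boundary cases later. -/
lemma sum_hop_left (N : ℕ) (b : Fin (N + 1)) (f : ℝ → ℝ) :
    ∑ a, hop N a b * f (mag N a) =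
      (spin N * (spin N + 1) - mag N b * (mag N b + 1)) * f (mag N b + 1) := by
  rcases exists_succ_or N b with ⟨a, ha⟩ | ⟨h, h0⟩
  · rw [Finset.sum_eq_single a]
    · simp [hop, ha, mag_of_succ ha]
    · intro c _ hc
      have : (c : ℕ) ≠ (b : ℕ) + 1 := fun h => hc (Fin.ext (h.trans ha.symm))
      simp [hop, this]
    · simp
  · rw [h0, zero_mul]
    exact Finset.sum_eq_zero fun a _ => by simp [hop, h a]

lemma sum_hop_right (N : ℕ) (b : Fin (N + 1)) (f : ℝ → ℝ) :
    ∑ a, hop N b a * f (mag N a) =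
      (spin N * (spin N + 1) - mag N b * (mag N b - 1)) * f (mag N b - 1) := by
  rcases exists_pred_or N b with ⟨a, ha⟩ | ⟨h, h0⟩
  · rw [Finset.sum_eq_single a]
    · rw [mag_of_succ ha]
      simp only [hop, ha, if_true, add_sub_cancel_right]
      ring
    · intro c _ hc
      have : (b : ℕ) ≠ (c : ℕ) + 1 := fun h => hc (Fin.ext (by omega))
      simp [hop, this]
    · simp
  · rw [h0, zero_mul]
    exact Finset.sum_eq_zero fun a _ => by simp [hop, h a]

/-- The terms with two raising or two lowering operators cancel between the `x` and `y`
contributions. -/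
lemma sum_J_mul_mul_J (N : ℕ) (X : Matrix (Fin (N + 1)) (Fin (N + 1)) ℂ) :
    ∑ k : Fin 3, J N k * X * J N k = Jz N * X * Jz N +
      (1 / 2 : ℂ) • (Jplus N * X * (Jplus N)ᴴ + (Jplus N)ᴴ * X * Jplus N) := by
  have hI : (1 / (2 * Complex.I)) * (1 / (2 * Complex.I)) = (-(1 / 4) : ℂ) := by
    field_simp
    rw [Complex.I_sq]
    norm_num
  simp only [Fin.sum_univ_three, J, Jx, Jy, Matrix.cons_val_zero, Matrix.cons_val_one,
    Matrix.cons_val, Matrix.smul_mul, Matrix.mul_smul, smul_smul, hI]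
  simp only [add_mul, mul_add, sub_mul, mul_sub]
  module

/-- Each row of `J₊` has at most one nonzero entry, so off-diagonal entries of `X` never reach the
diagonal of `J₊ X J₋`. -/
lemma Jplus_mul_star (N : ℕ) (a b c : Fin (N + 1)) :
    Jplus N a b * star (Jplus N a c) = if b = c then ((hop N a b : ℝ) : ℂ) else 0 := by
  simp only [Jplus, Matrix.of_apply, hop]
  by_cases hb : (a : ℕ) = (b : ℕ) + 1
  · by_cases hc : b = c
    · subst hc
      simp only [hb, if_true]
      rw [Complex.star_def, Complex.conj_ofReal, ← Complex.ofReal_mul,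
        Real.mul_self_sqrt (raising_coeff_nonneg (abs_mag_le N b))]
    · have : (a : ℕ) ≠ (c : ℕ) + 1 := fun h => hc (Fin.ext (by omega))
      simp [this, hc]
  · simp [hb]

lemma star_Jplus_mul (N : ℕ) (a b c : Fin (N + 1)) :
    star (Jplus N b a) * Jplus N c a = if b = c then ((hop N b a : ℝ) : ℂ) else 0 := by
  simp only [Jplus, Matrix.of_apply, hop]
  by_cases hb : (b : ℕ) = (a : ℕ) + 1
  · by_cases hc : b = c
    · subst hc
      simp only [hb, if_true]
      rw [Complex.star_def, Complex.conj_ofReal, ← Complex.ofReal_mul,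
        Real.mul_self_sqrt (raising_coeff_nonneg (abs_mag_le N a))]
    · have : (c : ℕ) ≠ (a : ℕ) + 1 := fun h => hc (Fin.ext (by omega))
      simp [this, hc]
  · simp [hb]

lemma raise_diag (N : ℕ) (X : Matrix (Fin (N + 1)) (Fin (N + 1)) ℂ) (a : Fin (N + 1)) :
    ((Jplus N * X * (Jplus N)ᴴ) a a).re = ∑ b, hop N a b * (X b b).re := by
  have : (Jplus N * X * (Jplus N)ᴴ) a a = ∑ b, ((hop N a b : ℝ) : ℂ) * X b b := by
    simp only [Matrix.mul_apply, Matrix.conjTranspose_apply, Finset.sum_mul]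
    rw [Finset.sum_comm]
    refine Finset.sum_congr rfl fun b _ => ?_
    have (c : Fin (N + 1)) : Jplus N a b * X b c * star (Jplus N a c) =
        if b = c then ((hop N a b : ℝ) : ℂ) * X b c else 0 := by
      rw [mul_right_comm, Jplus_mul_star]
      split_ifs <;> simp
    rw [Finset.sum_congr rfl fun c _ => this c]
    simp
  rw [this, Complex.re_sum]
  simp

lemma lower_diag (N : ℕ) (X : Matrix (Fin (N + 1)) (Fin (N + 1)) ℂ) (a : Fin (N + 1)) :
    (((Jplus N)ᴴ * X * Jplus N) a a).re = ∑ b, hop N b a * (X b b).re := by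
  have : ((Jplus N)ᴴ * X * Jplus N) a a = ∑ b, ((hop N b a : ℝ) : ℂ) * X b b := by
    simp only [Matrix.mul_apply, Matrix.conjTranspose_apply, Finset.sum_mul]
    rw [Finset.sum_comm]
    refine Finset.sum_congr rfl fun b _ => ?_
    have (c : Fin (N + 1)) : star (Jplus N b a) * X b c * Jplus N c a =
        if b = c then ((hop N b a : ℝ) : ℂ) * X b c else 0 := by
      rw [mul_right_comm, star_Jplus_mul]
      split_ifs <;> simp
    rw [Finset.sum_congr rfl fun c _ => this c]
    simp
  rw [this, Complex.re_sum]
  simp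

lemma zeta_diag (N : ℕ) (X : Matrix (Fin (N + 1)) (Fin (N + 1)) ℂ) (a : Fin (N + 1)) :
    (zeta N X a a).re = 1 / (spin N * (spin N + 1)) *
      (mag N a ^ 2 * (X a a).re + 1 / 2 * ∑ b, hop N a b * (X b b).re +
        1 / 2 * ∑ b, hop N b a * (X b b).re) := by
  have hz : ((Jz N * X * Jz N) a a).re = mag N a ^ 2 * (X a a).re := by
    simp only [Jz, Matrix.mul_diagonal, Matrix.diagonal_mul]
    rw [mul_right_comm, ← Complex.ofReal_mul, Complex.re_ofReal_mul, sq]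
  rw [zeta, sum_J_mul_mul_J, Matrix.smul_apply, smul_eq_mul, Complex.re_ofReal_mul,
    Matrix.add_apply, Complex.add_re, hz, Matrix.smul_apply, Matrix.add_apply, smul_eq_mul,
    show (1 / 2 : ℂ) = ((1 / 2 : ℝ) : ℂ) by norm_num, Complex.re_ofReal_mul, Complex.add_re,
    raise_diag, lower_diag]
  ring

/-- Summation by parts moves the hops from the diagonal of `X` to `f`; from here on matrices enter
only through means. -/
lemma mean_zeta {N : ℕ} (X : Matrix (Fin (N + 1)) (Fin (N + 1)) ℂ) (f : ℝ → ℝ) :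
    mean (zeta N X) f = mean X (walk N f) := by
  have h1 : ∑ a, (∑ b, hop N a b * (X b b).re) * f (mag N a) =
      ∑ b, (X b b).re * ((spin N * (spin N + 1) - mag N b * (mag N b + 1)) *
        f (mag N b + 1)) := by
    simp only [← sum_hop_left, Finset.sum_mul, Finset.mul_sum]
    rw [Finset.sum_comm]
    exact Finset.sum_congr rfl fun b _ => Finset.sum_congr rfl fun a _ => by ring
  have h2 : ∑ a, (∑ b, hop N b a * (X b b).re) * f (mag N a) =
      ∑ b, (X b b).re * ((spin N * (spin N + 1) - mag N b * (mag N b - 1)) *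
        f (mag N b - 1)) := by
    simp only [← sum_hop_right, Finset.sum_mul, Finset.mul_sum]
    rw [Finset.sum_comm]
    exact Finset.sum_congr rfl fun b _ => Finset.sum_congr rfl fun a _ => by ring
  have hl : mean (zeta N X) f = 1 / (spin N * (spin N + 1)) *
      (∑ a, (X a a).re * (mag N a ^ 2 * f (mag N a)) +
        1 / 2 * ∑ a, (∑ b, hop N a b * (X b b).re) * f (mag N a) +
        1 / 2 * ∑ a, (∑ b, hop N b a * (X b b).re) * f (mag N a)) := by
    simp only [mean, zeta_diag]
    rw [Finset.mul_sum Finset.univ _ (1 / 2 : ℝ), Finset.mul_sum Finset.univ _ (1 / 2 : ℝ),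
      ← Finset.sum_add_distrib, ← Finset.sum_add_distrib, Finset.mul_sum]
    exact Finset.sum_congr rfl fun a _ => by ring
  rw [hl, h1, h2, mean]
  simp only [walk]
  rw [Finset.mul_sum Finset.univ _ (1 / 2 : ℝ), Finset.mul_sum Finset.univ _ (1 / 2 : ℝ),
      ← Finset.sum_add_distrib, ← Finset.sum_add_distrib, Finset.mul_sum]
  exact Finset.sum_congr rfl fun a _ => by ring

lemma mean_zeta_iterate {N : ℕ} (n : ℕ) (X : Matrix (Fin (N + 1)) (Fin (N + 1)) ℂ)
    (f : ℝ → ℝ) : mean ((zeta N)^[n] X) f = mean X ((walk N)^[n] f) := by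
  induction n generalizing f with
  | zero => rfl
  | succ n ih =>
    rw [Function.iterate_succ_apply', mean_zeta, ih, Function.iterate_succ_apply]

lemma moment_eq_mean (N ℓ : ℕ) (X : Matrix (Fin (N + 1)) (Fin (N + 1)) ℂ) :
    moment N ℓ X = mean X fun m => m ^ ℓ := by
  simp only [moment, mean, Jz, Matrix.diagonal_pow, Matrix.trace, Matrix.diag_apply,
    Matrix.mul_diagonal, Complex.re_sum]
  refine Finset.sum_congr rfl fun i _ => ?_
  rw [Pi.pow_apply, ← Complex.ofReal_pow, Complex.re_mul_ofReal]

/-! ### States -/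

lemma IsState.diag_nonneg {N : ℕ} {X : Matrix (Fin (N + 1)) (Fin (N + 1)) ℂ} (h : IsState X)
    (i : Fin (N + 1)) : 0 ≤ (X i i).re :=
  (Complex.le_def.1 (h.1.diag_nonneg (i := i))).1

lemma IsState.sum_diag {N : ℕ} {X : Matrix (Fin (N + 1)) (Fin (N + 1)) ℂ} (h : IsState X) :
    ∑ i, (X i i).re = 1 := by
  have := congrArg Complex.re h.2
  simpa [Matrix.trace, Complex.re_sum] using this

lemma IsState.abs_mean_le {N : ℕ} {X : Matrix (Fin (N + 1)) (Fin (N + 1)) ℂ} (h : IsState X)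
    {f : ℝ → ℝ} {K : ℝ} (hf : ∀ i, |f (mag N i)| ≤ K) : |mean X f| ≤ K := by
  calc |mean X f| ≤ ∑ i, |(X i i).re * f (mag N i)| := Finset.abs_sum_le_sum_abs _ _
    _ ≤ ∑ i, (X i i).re * K := Finset.sum_le_sum fun i _ => by
        rw [abs_mul, abs_of_nonneg (h.diag_nonneg i)]
        exact mul_le_mul_of_nonneg_left (hf i) (h.diag_nonneg i)
    _ = K := by rw [← Finset.sum_mul, h.sum_diag, one_mul]

lemma IsState.mean_mono {N : ℕ} {X : Matrix (Fin (N + 1)) (Fin (N + 1)) ℂ} (h : IsState X)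
    {f g : ℝ → ℝ} (hf : ∀ i, f (mag N i) ≤ g (mag N i)) : mean X f ≤ mean X g :=
  Finset.sum_le_sum fun i _ => mul_le_mul_of_nonneg_left (hf i) (h.diag_nonneg i)

lemma IsState.mean_one {N : ℕ} {X : Matrix (Fin (N + 1)) (Fin (N + 1)) ℂ} (h : IsState X) :
    mean X (fun _ => 1) = 1 := by
  simp [mean, h.sum_diag]

/-- Complete positivity with a one-dimensional ancilla. -/
lemma IsChannel.posSemidef {n : Type*} [Fintype n] {Φ : Matrix n n ℂ →ₗ[ℂ] Matrix n n ℂ}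
    (h : IsChannel Φ) {X : Matrix n n ℂ} (hX : X.PosSemidef) : (Φ X).PosSemidef := by
  have h1 := h.1 1 (X.submatrix Prod.fst Prod.fst) (hX.submatrix _)
  have h2 := h1.submatrix (fun a : n => (a, (0 : Fin 1)))
  exact h2

lemma traceRight_posSemidef {m r : Type*} [Fintype r] [Fintype m] {X : Matrix (m × r) (m × r) ℂ}
    (h : X.PosSemidef) : (traceRight X).PosSemidef := by
  have : traceRight X = ∑ i, X.submatrix (fun a => (a, i)) (fun a => (a, i)) := by
    ext a b
    simp [traceRight, Matrix.sum_apply]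
  rw [this]
  exact Matrix.posSemidef_sum _ fun i _ => h.submatrix _

lemma trace_traceRight {m r : Type*} [Fintype r] [Fintype m] (X : Matrix (m × r) (m × r) ℂ) :
    (traceRight X).trace = X.trace := by
  simp [Matrix.trace, traceRight, Fintype.sum_prod_type]

lemma JointOperation.isState_disturbance {N : ℕ} (E : JointOperation N)
    {X : Matrix (Fin (N + 1)) (Fin (N + 1)) ℂ} (h : IsState X) : IsState (E.disturbance X) := by
  refine ⟨traceRight_posSemidef (E.isChannel.posSemidef (h.1.kronecker E.isState.1)), ?_⟩
  rw [disturbance, trace_traceRight, E.isChannel.2, Matrix.trace_kronecker, h.2, E.isState.2,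
    one_mul]

lemma JointOperation.stateAfter_succ {N : ℕ} (E : JointOperation N)
    (X : Matrix (Fin (N + 1)) (Fin (N + 1)) ℂ) (t : ℕ) :
    E.stateAfter X (t + 1) = E.disturbance (E.stateAfter X t) :=
  Function.iterate_succ_apply' _ _ _

lemma JointOperation.isState_stateAfter {N : ℕ} (E : JointOperation N)
    {X : Matrix (Fin (N + 1)) (Fin (N + 1)) ℂ} (h : IsState X) (t : ℕ) :
    IsState (E.stateAfter X t) := by
  induction t with
  | zero => exact h
  | succ t ih =>
    rw [E.stateAfter_succ]
    exact E.isState_disturbance ih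

/-- The projection `|i⟩⟨i|` is a state. -/
lemma isState_single {N : ℕ} (i : Fin (N + 1)) :
    IsState (Matrix.diagonal (Pi.single i 1) : Matrix (Fin (N + 1)) (Fin (N + 1)) ℂ) := by
  refine ⟨Matrix.PosSemidef.diagonal fun k => ?_, ?_⟩
  · by_cases h : k = i
    · subst h; simp
    · simp [h]
  · simp [Matrix.trace]

lemma mean_single {N : ℕ} (i : Fin (N + 1)) (f : ℝ → ℝ) :
    mean (Matrix.diagonal (Pi.single i 1) : Matrix (Fin (N + 1)) (Fin (N + 1)) ℂ) f =
      f (mag N i) := by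
  rw [mean, Finset.sum_eq_single i]
  · simp
  · intro k _ hk
    simp [hk]
  · simp

/-! ### The action of `ζ` on powers of `J_z` -/

lemma walk_smul (N : ℕ) (c : ℝ) (f : ℝ → ℝ) : walk N (c • f) = c • walk N f := by
  ext m
  simp only [walk, Pi.smul_apply, smul_eq_mul]
  ring

lemma walk_sub (N : ℕ) (f g : ℝ → ℝ) : walk N (f - g) = walk N f - walk N g := by
  ext m
  simp only [walk, Pi.sub_apply]
  ring

/-- On the spectrum the three weights of the walk are nonnegative and sum to 1, and those leading
out of the spectrum vanish. Hence the walk contracts the sup norm, which keeps errors from growing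
under iteration. -/
lemma walk_abs_le {N : ℕ} (hN : 0 < spin N) {f : ℝ → ℝ} {K : ℝ}
    (hf : ∀ i, |f (mag N i)| ≤ K) (i : Fin (N + 1)) : |walk N f (mag N i)| ≤ K := by
  have hs : 0 < spin N * (spin N + 1) := by positivity
  have hr := raising_coeff_nonneg (abs_mag_le N i)
  have hl := lowering_coeff_nonneg (abs_mag_le N i)
  set s := spin N * (spin N + 1) with hs_def
  set m := mag N i with hm
  have h1 : |(s - m * (m + 1)) * f (m + 1)| ≤ (s - m * (m + 1)) * K := by
    rcases exists_succ_or N i with ⟨a, ha⟩ | ⟨-, h0⟩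
    · rw [hm, ← mag_of_succ ha, abs_mul, mag_of_succ ha, ← hm, abs_of_nonneg hr, hm,
        ← mag_of_succ ha]
      have := hf a
      exact mul_le_mul_of_nonneg_left this (by rw [mag_of_succ ha, ← hm]; exact hr)
    · rw [← hm, ← hs_def] at h0
      rw [h0]
      simp
  have h2 : |(s - m * (m - 1)) * f (m - 1)| ≤ (s - m * (m - 1)) * K := by
    rcases exists_pred_or N i with ⟨a, ha⟩ | ⟨-, h0⟩
    · have e : m - 1 = mag N a := by rw [hm, mag_of_succ ha]; ring
      rw [abs_mul, abs_of_nonneg hl]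
      refine mul_le_mul_of_nonneg_left ?_ hl
      rw [e]
      exact hf a
    · rw [← hm, ← hs_def] at h0
      rw [h0]
      simp
  have h3 : |m ^ 2 * f m| ≤ m ^ 2 * K := by
    rw [abs_mul, abs_of_nonneg (sq_nonneg m)]
    exact mul_le_mul_of_nonneg_left (hf i) (sq_nonneg m)
  rw [walk, ← hs_def, abs_mul, abs_of_pos (by positivity : 0 < 1 / s), one_div,
    inv_mul_le_iff₀ hs]
  rw [abs_le] at *
  constructor <;> linarith [h1.1, h1.2, h2.1, h2.2, h3.1, h3.2]

lemma walk_one {N : ℕ} (hN : 0 < spin N) : walk N (fun _ => 1) = fun _ => 1 := by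
  ext m
  have : spin N * (spin N + 1) ≠ 0 := by positivity
  simp only [walk]
  field_simp
  ring

lemma walk_iterate_one {N : ℕ} (hN : 0 < spin N) (n : ℕ) :
    (walk N)^[n] (fun _ => 1) = fun _ => 1 :=
  Function.iterate_fixed (walk_one hN) n

lemma natCast_mul_pow_pred (k : ℕ) (x : ℝ) : k * x ^ (k - 1) * x = k * x ^ k := by
  cases k with
  | zero => simp
  | succ k => rw [Nat.add_sub_cancel, pow_succ, mul_assoc]

/-- The truncated exponents at `k = 0, 1` are harmless because the coefficient vanishes there. -/
lemma mul_pow_sub_two (k : ℕ) (x : ℝ) :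
    k * (k - 1) * x ^ (k - 2) * x = k * (k - 1) * x ^ (k - 1) := by
  rcases k with _ | _ | k
  · simp
  · simp
  · rw [show k + 1 + 1 - 2 = k by omega, show k + 1 + 1 - 1 = k + 1 by omega, pow_succ]
    ring

/-- Central differences of a power, up to higher order. -/
lemma exists_central_difference_bound (k : ℕ) : ∃ K, 0 ≤ K ∧ ∀ x h : ℝ, |x| ≤ 1 → 0 ≤ h → h ≤ 1 →
    |(x + h) ^ k - (x - h) ^ k - 2 * (k * x ^ (k - 1)) * h| ≤ K * h ^ 2 ∧
    |(x + h) ^ k + (x - h) ^ k - 2 * x ^ k - k * (k - 1) * x ^ (k - 2) * h ^ 2| ≤ K * h ^ 3 := by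
  induction k with
  | zero => exact ⟨0, le_rfl, fun x h _ _ _ => by norm_num⟩
  | succ k ih =>
    obtain ⟨K, hK, ih⟩ := ih
    refine ⟨2 * K + |(k : ℝ) * (k - 1)|, by positivity, fun x h hx h0 h1 => ?_⟩
    obtain ⟨hT, hS⟩ := ih x h hx h0 h1
    set T := (x + h) ^ k - (x - h) ^ k - 2 * (k * x ^ (k - 1)) * h with hTd
    set S := (x + h) ^ k + (x - h) ^ k - 2 * x ^ k - k * (k - 1) * x ^ (k - 2) * h ^ 2 with hSd
    have e1 := natCast_mul_pow_pred k x
    have e2 := mul_pow_sub_two k x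
    -- Splitting off one factor `x ± h` couples the remainders of the odd and even differences, so
    -- both are estimated in one induction.
    have eT : (x + h) ^ (k + 1) - (x - h) ^ (k + 1) -
        2 * (((k + 1 : ℕ) : ℝ) * x ^ (k + 1 - 1)) * h =
        x * T + h * S + k * (k - 1) * x ^ (k - 2) * h ^ 3 := by
      rw [hTd, hSd, Nat.add_sub_cancel]
      push_cast
      linear_combination 2 * h * e1
    have eS : (x + h) ^ (k + 1) + (x - h) ^ (k + 1) - 2 * x ^ (k + 1) -
        ((k + 1 : ℕ) : ℝ) * (((k + 1 : ℕ) : ℝ) - 1) * x ^ (k + 1 - 2) * h ^ 2 =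
        x * S + h * T := by
      rw [hTd, hSd, show k + 1 - 2 = k - 1 by omega]
      push_cast
      linear_combination h ^ 2 * e2
    have hx' (y : ℝ) : |x * y| ≤ |y| := by
      rw [abs_mul]
      exact mul_le_of_le_one_left (abs_nonneg _) hx
    have hh (y : ℝ) : |h * y| = h * |y| := by rw [abs_mul, abs_of_nonneg h0]
    have hp : |x ^ (k - 2)| ≤ 1 := by
      rw [abs_pow]
      exact pow_le_one₀ (abs_nonneg _) hx
    have h32 : h ^ 3 ≤ h ^ 2 := pow_le_pow_of_le_one h0 h1 (by norm_num)
    have h43 : h ^ 4 ≤ h ^ 2 := pow_le_pow_of_le_one h0 h1 (by norm_num)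
    constructor
    · rw [eT]
      have hlast : |(k : ℝ) * (k - 1) * x ^ (k - 2) * h ^ 3| ≤ |(k : ℝ) * (k - 1)| * h ^ 2 := by
        rw [abs_mul, abs_mul, abs_of_nonneg (by positivity : 0 ≤ h ^ 3)]
        exact mul_le_mul (mul_le_of_le_one_right (abs_nonneg _) hp) h32 (by positivity)
          (abs_nonneg _)
      calc _ ≤ |x * T| + |h * S| + |(k : ℝ) * (k - 1) * x ^ (k - 2) * h ^ 3| := abs_add_three _ _ _
        _ ≤ K * h ^ 2 + h * (K * h ^ 3) + |(k : ℝ) * (k - 1)| * h ^ 2 := by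
          rw [hh]
          gcongr
          exact (hx' T).trans hT
        _ ≤ _ := by nlinarith [mul_le_mul_of_nonneg_left h43 hK]
    · rw [eS]
      calc _ ≤ |x * S| + |h * T| := abs_add_le _ _
        _ ≤ K * h ^ 3 + h * (K * h ^ 2) := by
          rw [hh]
          gcongr
          exact (hx' S).trans hS
        _ ≤ _ := by nlinarith [mul_nonneg (abs_nonneg ((k : ℝ) * (k - 1))) (pow_nonneg h0 3)]

/-- The powers of `J_z / j`. -/
def relPow (N k : ℕ) : ℝ → ℝ := fun m => (m / spin N) ^ k

/-- The generator of the large-`j` limit of `ζ` on powers of `J_z / j`. -/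
def legendre (N k : ℕ) : ℝ → ℝ :=
  (1 / 2 * (k * (k - 1)) : ℝ) • relPow N (k - 2) - (1 / 2 * (k * (k + 1)) : ℝ) • relPow N k

lemma abs_div_spin_le {N : ℕ} {m : ℝ} (hm : |m| ≤ spin N) : |m / spin N| ≤ 1 := by
  rw [abs_div, abs_of_nonneg (spin_nonneg N)]
  exact div_le_one_of_le₀ hm (spin_nonneg N)

lemma abs_relPow_le {N : ℕ} (k : ℕ) {m : ℝ} (hm : |m| ≤ spin N) : |relPow N k m| ≤ 1 := by
  rw [relPow, abs_pow]
  exact pow_le_one₀ (abs_nonneg _) (abs_div_spin_le hm)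

lemma exists_abs_legendre_le (k : ℕ) : ∃ K, 0 ≤ K ∧ ∀ (N : ℕ) (m : ℝ), |m| ≤ spin N →
    |legendre N k m| ≤ K := by
  refine ⟨|(1 / 2 * (k * (k - 1)) : ℝ)| + |(1 / 2 * (k * (k + 1)) : ℝ)|, by positivity,
    fun N m hm => ?_⟩
  simp only [legendre, Pi.sub_apply, Pi.smul_apply, smul_eq_mul]
  refine (abs_sub _ _).trans (add_le_add ?_ ?_) <;> rw [abs_mul] <;>
  exact mul_le_of_le_one_right (abs_nonneg _) (abs_relPow_le _ hm)

/-- With $x=m/j$ and $h=1/j$, the second difference contributes $\frac12(1-x^2)f''$ and the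
asymmetry of the two hops contributes $-xf'$. For $f=x^k$ their sum is
$\frac12k(k-1)x^{k-2}-\frac12k(k+1)x^k$. -/
lemma exists_walk_relPow_bound (k : ℕ) : ∃ K, 0 ≤ K ∧ ∀ (N : ℕ), 1 ≤ spin N → ∀ m,
    |m| ≤ spin N →
    |walk N (relPow N k) m - relPow N k m - (1 / spin N) ^ 2 * legendre N k m| ≤
      K * (1 / spin N) ^ 3 := by
  obtain ⟨K, hK, hd⟩ := exists_central_difference_bound k
  refine ⟨K + |(1 / 2 * (k * (k + 1)) : ℝ)|, by positivity, fun N hN m hm => ?_⟩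
  have hpos : 0 < spin N := by linarith
  have hx := abs_div_spin_le hm
  have h0 : 0 ≤ 1 / spin N := by positivity
  have h1 : 1 / spin N ≤ 1 := by rw [div_le_one hpos]; exact hN
  obtain ⟨hT, hS⟩ := hd _ _ hx h0 h1
  set x := m / spin N with hxd
  set h := 1 / spin N with hhd
  -- This is $j^2/(j(j+1))$, the normalisation of `ζ` in rescaled variables.
  set u := 1 / (1 + h) with hu
  have hu0 : 0 ≤ u := by positivity
  have hu1 : u ≤ 1 := by rw [hu, div_le_one (by linarith)]; linarith
  have huh : 1 - u = h * u := by rw [hu]; field_simp; ring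
  set T := (x + h) ^ k - (x - h) ^ k - 2 * (k * x ^ (k - 1)) * h with hTd
  set S := (x + h) ^ k + (x - h) ^ k - 2 * x ^ k - k * (k - 1) * x ^ (k - 2) * h ^ 2 with hSd
  have e1 := natCast_mul_pow_pred k x
  have e2 := mul_pow_sub_two k x
  have ew : walk N (relPow N k) m = x ^ 2 * u * x ^ k +
      1 / 2 * ((1 - x ^ 2 * u - x * h * u) * (x + h) ^ k) +
      1 / 2 * ((1 - x ^ 2 * u + x * h * u) * (x - h) ^ k) := by
    have hm' : m = x * spin N := by rw [hxd]; field_simp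
    have hj : spin N * h = 1 := by rw [hhd]; field_simp
    have hj1 : spin N + 1 ≠ 0 := by positivity
    have hu' : u = spin N / (spin N + 1) := by
      rw [hu, hhd]; field_simp
    simp only [walk, relPow]
    rw [show (m + 1) / spin N = x + h by rw [add_div],
      show (m - 1) / spin N = x - h by rw [sub_div], ← hxd, hu', hm', hhd]
    field_simp
    ring
  -- The first term is the cost of replacing `u` by 1, which is of third order since `1 - u = h *
  -- u`; the others are the difference remainders.
  have key : walk N (relPow N k) m - relPow N k m - h ^ 2 * legendre N k m =
      1 / 2 * (k * (k + 1)) * (h ^ 3 * u * x ^ k) + 1 / 2 * ((1 - x ^ 2 * u) * S) -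
        1 / 2 * (x * u * (h * T)) := by
    rw [ew]
    simp only [legendre, relPow, Pi.sub_apply, Pi.smul_apply, smul_eq_mul, ← hxd]
    rw [show h ^ 3 * u * x ^ k = h ^ 2 * (1 - u) * x ^ k by rw [huh]; ring, hSd, hTd]
    linear_combination (-u * h ^ 2) * e1 - 1 / 2 * u * h ^ 2 * (x * e2 + ((k : ℝ) - 1) * e1)
  have hx2 : x ^ 2 ≤ 1 := by rw [← sq_abs]; exact pow_le_one₀ (abs_nonneg _) hx
  have hxu : |x * u| ≤ 1 := by
    rw [abs_mul, abs_of_nonneg hu0]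
    exact mul_le_one₀ hx hu0 hu1
  have hxu2 : |1 - x ^ 2 * u| ≤ 1 := by
    have l := mul_nonneg (sq_nonneg x) hu0
    have r := mul_le_one₀ hx2 hu0 hu1
    rw [abs_le]
    constructor <;> linarith only [l, r]
  have hxk : |x ^ k| ≤ 1 := by
    rw [abs_pow]
    exact pow_le_one₀ (abs_nonneg _) hx
  have b1 : |1 / 2 * (k * (k + 1)) * (h ^ 3 * u * x ^ k)| ≤
      |(1 / 2 * (k * (k + 1)) : ℝ)| * h ^ 3 := by
    rw [abs_mul]
    refine mul_le_mul_of_nonneg_left ?_ (abs_nonneg _)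
    rw [mul_assoc, abs_mul, abs_of_nonneg (by positivity : 0 ≤ h ^ 3)]
    refine mul_le_of_le_one_right (by positivity) ?_
    rw [abs_mul, abs_of_nonneg hu0]
    exact mul_le_one₀ hu1 (abs_nonneg _) hxk
  have b2 : |1 / 2 * ((1 - x ^ 2 * u) * S)| ≤ 1 / 2 * (K * h ^ 3) := by
    rw [abs_mul, abs_mul, abs_of_pos (by norm_num : (0 : ℝ) < 1 / 2)]
    refine mul_le_mul_of_nonneg_left ?_ (by norm_num)
    exact (mul_le_of_le_one_left (abs_nonneg _) hxu2).trans hS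
  have b3 : |1 / 2 * (x * u * (h * T))| ≤ 1 / 2 * (K * h ^ 3) := by
    rw [abs_mul, abs_mul, abs_of_pos (by norm_num : (0 : ℝ) < 1 / 2)]
    refine mul_le_mul_of_nonneg_left ?_ (by norm_num)
    refine (mul_le_of_le_one_left (abs_nonneg _) hxu).trans ?_
    rw [abs_mul, abs_of_nonneg h0]
    calc h * |T| ≤ h * (K * h ^ 2) := mul_le_mul_of_nonneg_left hT h0
      _ = K * h ^ 3 := by ring
  rw [key]
  rw [abs_le] at b1 b2 b3 ⊢
  constructor <;> linarith only [b1.1, b1.2, b2.1, b2.2, b3.1, b3.2]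

/-- In the iteration this correction already carries a factor $j^{-2}$, so its own change under the
walk ends up at order $j^{-4}$. -/
lemma exists_walk_legendre_bound (k : ℕ) : ∃ K, 0 ≤ K ∧ ∀ (N : ℕ), 1 ≤ spin N → ∀ m,
    |m| ≤ spin N → |walk N (legendre N k) m - legendre N k m| ≤ K * (1 / spin N) ^ 2 := by
  have step (k : ℕ) : ∃ K, 0 ≤ K ∧ ∀ (N : ℕ), 1 ≤ spin N → ∀ m, |m| ≤ spin N →
      |walk N (relPow N k) m - relPow N k m| ≤ K * (1 / spin N) ^ 2 := by
    obtain ⟨K, hK, hb⟩ := exists_walk_relPow_bound k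
    obtain ⟨L, hL, hl⟩ := exists_abs_legendre_le k
    refine ⟨K + L, by positivity, fun N hN m hm => ?_⟩
    have hpos : 0 < spin N := by linarith
    have h0 : 0 ≤ 1 / spin N := by positivity
    have h1 : 1 / spin N ≤ 1 := by rw [div_le_one hpos]; exact hN
    have h32 : (1 / spin N) ^ 3 ≤ (1 / spin N) ^ 2 := pow_le_pow_of_le_one h0 h1 (by norm_num)
    have b := hb N hN m hm
    have l : |(1 / spin N) ^ 2 * legendre N k m| ≤ (1 / spin N) ^ 2 * L := by
      rw [abs_mul, abs_of_nonneg (by positivity : 0 ≤ (1 / spin N) ^ 2)]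
      exact mul_le_mul_of_nonneg_left (hl N m hm) (by positivity)
    have := mul_le_mul_of_nonneg_left h32 hK
    rw [abs_le] at b l ⊢
    constructor <;> linarith [b.1, b.2, l.1, l.2]
  obtain ⟨K, hK, hk⟩ := step k
  obtain ⟨L, hL, hl⟩ := step (k - 2)
  set α : ℝ := 1 / 2 * (k * (k - 1)) with hα
  set β : ℝ := 1 / 2 * (k * (k + 1)) with hβ
  refine ⟨|α| * L + |β| * K, by positivity, fun N hN m hm => ?_⟩
  have e : walk N (legendre N k) m - legendre N k m =
      α * (walk N (relPow N (k - 2)) m - relPow N (k - 2) m) -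
        β * (walk N (relPow N k) m - relPow N k m) := by
    simp only [legendre, walk_sub, walk_smul, Pi.sub_apply, Pi.smul_apply, smul_eq_mul,
      ← hα, ← hβ]
    ring
  rw [e]
  calc _ ≤ |α * (walk N (relPow N (k - 2)) m - relPow N (k - 2) m)| +
        |β * (walk N (relPow N k) m - relPow N k m)| := abs_sub _ _
    _ ≤ |α| * (L * (1 / spin N) ^ 2) + |β| * (K * (1 / spin N) ^ 2) := by
      rw [abs_mul α, abs_mul β]
      gcongr
      · exact hl N hN m hm
      · exact hk N hN m hm
    _ = _ := by ring

lemma exists_walk_iterate_bound (k n : ℕ) : ∃ K, 0 ≤ K ∧ ∀ (N : ℕ), 1 ≤ spin N →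
    ∀ i : Fin (N + 1),
    |(walk N)^[n] (relPow N k) (mag N i) - relPow N k (mag N i) -
        n * ((1 / spin N) ^ 2 * legendre N k (mag N i))| ≤ K * (1 / spin N) ^ 3 := by
  induction n with
  | zero => exact ⟨0, le_rfl, fun N _ i => by simp⟩
  | succ n ih =>
    obtain ⟨A, hA, ha⟩ := ih
    obtain ⟨B, hB, hb⟩ := exists_walk_relPow_bound k
    obtain ⟨C, hC, hc⟩ := exists_walk_legendre_bound k
    refine ⟨A + B + n * C, by positivity, fun N hN i => ?_⟩
    have hpos : 0 < spin N := by linarith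
    have h0 : 0 ≤ 1 / spin N := by positivity
    have h1 : 1 / spin N ≤ 1 := by rw [div_le_one hpos]; exact hN
    -- The walk is applied to the whole error function of the previous step, whose bound survives by
    -- contraction.
    have a := walk_abs_le hpos (f := (walk N)^[n] (relPow N k) - relPow N k -
      ((n : ℝ) * (1 / spin N) ^ 2) • legendre N k) (K := A * (1 / spin N) ^ 3)
      (fun i => by
        have := ha N hN i
        simp only [Pi.sub_apply, Pi.smul_apply, smul_eq_mul]
        rwa [mul_assoc]) i
    have b := hb N hN (mag N i) (abs_mag_le N i)
    have c := hc N hN (mag N i) (abs_mag_le N i)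
    rw [walk_sub, walk_sub, walk_smul] at a
    simp only [Pi.sub_apply, Pi.smul_apply, smul_eq_mul] at a
    rw [Function.iterate_succ_apply']
    set h := 1 / spin N with hh
    have c' : |(n : ℝ) * h ^ 2 * (walk N (legendre N k) (mag N i) - legendre N k (mag N i))| ≤
        n * C * h ^ 3 := by
      rw [abs_mul, abs_of_nonneg (by positivity : 0 ≤ (n : ℝ) * h ^ 2)]
      calc _ ≤ (n : ℝ) * h ^ 2 * (C * h ^ 2) := by gcongr
        _ = n * C * h ^ 4 := by ring
        _ ≤ _ := by
          have : h ^ 4 ≤ h ^ 3 := pow_le_pow_of_le_one h0 h1 (by norm_num)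
          gcongr
    push_cast
    rw [abs_le] at a b c' ⊢
    constructor <;> linarith [a.1, a.2, b.1, b.2, c'.1, c'.2]

/-! ### The effect of one use of the frame on the relative moments -/

lemma mean_sub {N : ℕ} (X : Matrix (Fin (N + 1)) (Fin (N + 1)) ℂ) (f g : ℝ → ℝ) :
    mean X (f - g) = mean X f - mean X g := by
  simp only [mean, Pi.sub_apply, mul_sub, Finset.sum_sub_distrib]

lemma mean_smul {N : ℕ} (X : Matrix (Fin (N + 1)) (Fin (N + 1)) ℂ) (c : ℝ) (f : ℝ → ℝ) :
    mean X (c • f) = c * mean X f := by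
  simp only [mean, Pi.smul_apply, smul_eq_mul, Finset.mul_sum]
  exact Finset.sum_congr rfl fun i _ => by ring

lemma mean_legendre {N : ℕ} (X : Matrix (Fin (N + 1)) (Fin (N + 1)) ℂ) (k : ℕ) :
    mean X (legendre N k) = 1 / 2 * (k * (k - 1)) * mean X (relPow N (k - 2)) -
      1 / 2 * (k * (k + 1)) * mean X (relPow N k) := by
  rw [legendre, mean_sub, mean_smul, mean_smul]

lemma moment_eq {N : ℕ} (hN : 0 < spin N) (ℓ : ℕ) (X : Matrix (Fin (N + 1)) (Fin (N + 1)) ℂ) :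
    moment N ℓ X = spin N ^ ℓ * mean X (relPow N ℓ) := by
  rw [moment_eq_mean, ← mean_smul]
  congr 1
  ext m
  simp only [Pi.smul_apply, smul_eq_mul, relPow]
  rw [← mul_pow, mul_div_cancel₀ _ hN.ne']

section OneStep

variable {N : ℕ} {E : JointOperation N} {c : ℕ → ℝ} {d : ℕ}

lemma JointOperation.mean_disturbance
    (hξ : ∀ X, E.disturbance X = ∑ n ∈ Finset.range (N + 1), ((c n : ℝ) : ℂ) • (zeta N)^[n] X)
    (hc : ∀ n, d ≤ n → c n = 0) (hd : d ≤ N + 1)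
    (X : Matrix (Fin (N + 1)) (Fin (N + 1)) ℂ) (f : ℝ → ℝ) :
    mean (E.disturbance X) f = ∑ n ∈ Finset.range d, c n * mean X ((walk N)^[n] f) := by
  have h1 : mean (E.disturbance X) f =
      ∑ n ∈ Finset.range (N + 1), c n * mean X ((walk N)^[n] f) := by
    simp only [← mean_zeta_iterate]
    rw [hξ]
    simp only [mean, Matrix.sum_apply, Matrix.smul_apply, smul_eq_mul, Complex.re_sum,
      Complex.re_ofReal_mul, Finset.sum_mul, Finset.mul_sum]
    rw [Finset.sum_comm]
    exact Finset.sum_congr rfl fun n _ => Finset.sum_congr rfl fun i _ => by ring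
  rw [h1]
  symm
  refine Finset.sum_subset (Finset.range_mono hd) fun n _ hn => ?_
  rw [hc n (by simpa using hn), zero_mul]

/-- Trace preservation, tested on one state: the walk fixes constants, so each iterate of `ζ`
contributes its coefficient. -/
lemma JointOperation.sum_coeff
    (hξ : ∀ X, E.disturbance X = ∑ n ∈ Finset.range (N + 1), ((c n : ℝ) : ℂ) • (zeta N)^[n] X)
    (hc : ∀ n, d ≤ n → c n = 0) (hd : d ≤ N + 1) (hN : 0 < spin N) :
    ∑ n ∈ Finset.range d, c n = 1 := by
  have h := isState_single (0 : Fin (N + 1))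
  have := E.mean_disturbance hξ hc hd _ (fun _ => 1) ▸ (E.isState_disturbance h).mean_one
  simpa [walk_iterate_one hN, h.mean_one] using this

end OneStep

/-- Averaging the iterate expansions with weights of sum 1 leaves $\sum_n n\,c_n$ as the effective
diffusion constant. The point is that `K` depends on neither the spin nor the operation. -/
lemma exists_step_bound (k d : ℕ) (Q : ℝ) (hQ : 0 ≤ Q) : ∃ K, 0 ≤ K ∧
    ∀ {N : ℕ} {E : JointOperation N} {c : ℕ → ℝ},
    (∀ X, E.disturbance X = ∑ n ∈ Finset.range (N + 1), ((c n : ℝ) : ℂ) • (zeta N)^[n] X) →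
    (∀ n, d ≤ n → c n = 0) → d ≤ N + 1 → 1 ≤ spin N → (∀ n, n < d → |c n| ≤ Q) →
    ∀ X, IsState X →
    |mean (E.disturbance X) (relPow N k) - mean X (relPow N k) -
      (∑ n ∈ Finset.range d, n * c n) * (1 / spin N) ^ 2 * mean X (legendre N k)| ≤
      K * (1 / spin N) ^ 3 := by
  choose K hK hb using exists_walk_iterate_bound k
  refine ⟨∑ n ∈ Finset.range d, Q * K n,
    Finset.sum_nonneg fun n _ => mul_nonneg hQ (hK n), fun {N E c} hξ hc hd hN hcQ X hX => ?_⟩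
  have hpos : 0 < spin N := by linarith
  have e : mean (E.disturbance X) (relPow N k) - mean X (relPow N k) -
      (∑ n ∈ Finset.range d, n * c n) * (1 / spin N) ^ 2 * mean X (legendre N k) =
      ∑ n ∈ Finset.range d, c n * mean X ((walk N)^[n] (relPow N k) - relPow N k -
        ((n : ℝ) * (1 / spin N) ^ 2) • legendre N k) := by
    have h1 : mean X (relPow N k) = ∑ n ∈ Finset.range d, c n * mean X (relPow N k) := by
      rw [← Finset.sum_mul, E.sum_coeff hξ hc hd hpos, one_mul]
    rw [E.mean_disturbance hξ hc hd]
    nth_rw 1 [h1]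
    rw [Finset.sum_mul, Finset.sum_mul, ← Finset.sum_sub_distrib, ← Finset.sum_sub_distrib]
    refine Finset.sum_congr rfl fun n _ => ?_
    rw [mean_sub, mean_sub, mean_smul]
    ring
  rw [e, Finset.sum_mul]
  refine (Finset.abs_sum_le_sum_abs _ _).trans (Finset.sum_le_sum fun n hn => ?_)
  rw [abs_mul, mul_assoc]
  refine mul_le_mul (hcQ n (by simpa using hn)) (hX.abs_mean_le fun i => ?_) (abs_nonneg _) hQ
  have := hb n N hN i
  simp only [Pi.sub_apply, Pi.smul_apply, smul_eq_mul]
  rwa [mul_assoc]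

/-! ### The large-`j` limit of the coefficients -/

lemma tendsto_spin : Tendsto spin atTop atTop :=
  tendsto_natCast_atTop_atTop.atTop_div_const (by norm_num : (0 : ℝ) < 2)

/-- Convergence is all that the proof extracts from rationality. -/
lemma IsBoundedRational.exists_tendsto {f : ℕ → ℝ} (h : IsBoundedRational f) :
    ∃ L, Tendsto f atTop (nhds L) := by
  obtain ⟨P, D, -, hPD, hf⟩ := h
  rcases hPD.lt_or_eq with hlt | heq
  · exact ⟨0, ((P.div_tendsto_atTop_zero_of_degree_lt D hlt).comp tendsto_spin).congr'
      (hf.mono fun N hN => hN.symm)⟩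
  · exact ⟨_, ((P.div_tendsto_atTop_leadingCoeff_div_of_degree_eq D heq).comp tendsto_spin).congr'
      (hf.mono fun N hN => hN.symm)⟩

/-! ### The limiting walk at the equator and the sign of the diffusion constant -/

/-- The simple random walk, the limit of the action of `ζ` near the equator. -/
def simpleWalk (f : ℝ → ℝ) (m : ℝ) : ℝ := 1 / 2 * f (m + 1) + 1 / 2 * f (m - 1)

/-- At fixed `m` the holding weight tends to 0 and both hopping weights tend to 1/2. -/
lemma tendsto_walk_iterate (n : ℕ) (f : ℝ → ℝ) (m : ℝ) :
    Tendsto (fun N => (walk N)^[n] f m) atTop (nhds (simpleWalk^[n] f m)) := by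
  induction n generalizing m with
  | zero => exact tendsto_const_nhds
  | succ n ih =>
    simp only [Function.iterate_succ_apply']
    have hs : Tendsto (fun N => spin N * (spin N + 1)) atTop atTop :=
      tendsto_spin.atTop_mul_atTop₀ (tendsto_atTop_add_const_right _ _ tendsto_spin)
    have hu : Tendsto (fun N => 1 / (spin N * (spin N + 1))) atTop (nhds 0) := by
      simp only [one_div]
      exact hs.inv_tendsto_atTop
    have key : Tendsto (fun N => m ^ 2 * (1 / (spin N * (spin N + 1))) * (walk N)^[n] f m +
        1 / 2 * ((1 - m * (m + 1) * (1 / (spin N * (spin N + 1)))) * (walk N)^[n] f (m + 1)) +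
        1 / 2 * ((1 - m * (m - 1) * (1 / (spin N * (spin N + 1)))) * (walk N)^[n] f (m - 1)))
        atTop (nhds (m ^ 2 * 0 * simpleWalk^[n] f m +
          1 / 2 * ((1 - m * (m + 1) * 0) * simpleWalk^[n] f (m + 1)) +
          1 / 2 * ((1 - m * (m - 1) * 0) * simpleWalk^[n] f (m - 1)))) :=
      (((hu.const_mul _).mul (ih m)).add
        (((tendsto_const_nhds.sub (hu.const_mul _)).mul (ih (m + 1))).const_mul _)).add
        (((tendsto_const_nhds.sub (hu.const_mul _)).mul (ih (m - 1))).const_mul _)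
    have e : simpleWalk (simpleWalk^[n] f) m = m ^ 2 * 0 * simpleWalk^[n] f m +
          1 / 2 * ((1 - m * (m + 1) * 0) * simpleWalk^[n] f (m + 1)) +
          1 / 2 * ((1 - m * (m - 1) * 0) * simpleWalk^[n] f (m - 1)) := by
      rw [simpleWalk]
      ring
    rw [e]
    refine key.congr' ?_
    filter_upwards [tendsto_spin.eventually_gt_atTop 0] with N hN
    rw [walk]
    field_simp

lemma simpleWalk_iterate_sq (n : ℕ) (m : ℝ) :
    simpleWalk^[n] (fun x => x ^ 2) m = m ^ 2 + n := by
  induction n generalizing m with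
  | zero => simp
  | succ n ih =>
    rw [Function.iterate_succ_apply', simpleWalk, ih, ih]
    push_cast
    ring

lemma simpleWalk_iterate_of_lt (d : ℝ) (n : ℕ) (m : ℝ) (h : m + n < d) :
    simpleWalk^[n] (fun x => if x = d then 1 else 0) m = 0 := by
  induction n generalizing m with
  | zero =>
    have : m ≠ d := by
      rintro rfl
      simp at h
    simp [this]
  | succ n ih =>
    push_cast at h
    rw [Function.iterate_succ_apply', simpleWalk, ih _ (by linarith), ih _ (by linarith)]
    ring

lemma simpleWalk_iterate_of_eq (d : ℝ) (n : ℕ) (m : ℝ) (h : m + n = d) :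
    simpleWalk^[n] (fun x => if x = d then 1 else 0) m = (1 / 2) ^ n := by
  induction n generalizing m with
  | zero =>
    have : m = d := by simpa using h
    simp [this]
  | succ n ih =>
    push_cast at h
    rw [Function.iterate_succ_apply', simpleWalk, ih _ (by linarith),
      simpleWalk_iterate_of_lt d n _ (by linarith)]
    ring

/-- If the disturbance does not fade away, then the limiting diffusion constant is positive. -/
lemma sum_mul_limit_pos {E : ∀ N : ℕ, JointOperation N} {q : ℕ → ℕ → ℝ}
    (hξ : ∀ N X, (E N).disturbance X =
      ∑ n ∈ Finset.range (N + 1), ((q n N : ℝ) : ℂ) • (zeta N)^[n] X)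
    {nmax : ℕ} (hnmax : ∀ n, nmax ≤ n → ∀ N, q n N = 0)
    {Q : ℕ → ℝ} (hQ : ∀ n, Tendsto (q n) atTop (nhds (Q n)))
    (hne : ∃ n, 1 ≤ n ∧ ¬ Tendsto (q n) atTop (nhds 0)) :
    0 < ∑ n ∈ Finset.range nmax, n * Q n := by
  obtain ⟨n₀, hn₀, hn₀'⟩ := hne
  have hQ₀ : Q n₀ ≠ 0 := fun h => hn₀' (h ▸ hQ n₀)
  have hlt (n : ℕ) (h : Q n ≠ 0) : n < nmax := by
    by_contra! hn
    refine h (tendsto_nhds_unique (hQ n) ?_)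
    rw [show q n = fun _ => 0 from funext (hnmax n hn)]
    exact tendsto_const_nhds
  -- Take the largest index with nonzero limit: a walk from 0 reaches the site `d` in no fewer than
  -- `d` steps, so among the limiting terms only this one charges it.
  obtain ⟨d, hd, hmax⟩ := ((Finset.range nmax).filter fun n => Q n ≠ 0).exists_max_image id
    ⟨n₀, by simp [hQ₀, hlt n₀ hQ₀]⟩
  simp only [Finset.mem_filter, Finset.mem_range, id] at hd hmax
  have hd1 : 1 ≤ d := hn₀.trans (hmax n₀ ⟨hlt n₀ hQ₀, hQ₀⟩)
  -- Magnetic number 0 occurs only for integer spin; a subsequence suffices, since the limits `Q n`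
  -- are already known to exist.
  have heven : Tendsto (fun r : ℕ => 2 * r) atTop atTop :=
    tendsto_id.const_mul_atTop' (by norm_num)
  have lim (f : ℝ → ℝ) : Tendsto (fun r : ℕ => ∑ n ∈ Finset.range nmax,
      q n (2 * r) * (walk (2 * r))^[n] f 0) atTop
      (nhds (∑ n ∈ Finset.range nmax, Q n * simpleWalk^[n] f 0)) :=
    tendsto_finsetSum _ fun n _ =>
      ((hQ n).comp heven).mul ((tendsto_walk_iterate n f 0).comp heven)
  set g : ℝ → ℝ := fun x => if x = (d : ℝ) then 1 else 0 with hg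
  have hg0 (x : ℝ) : 0 ≤ g x := by rw [hg]; dsimp only; split_ifs <;> norm_num
  have hgs (x : ℝ) : g x ≤ x ^ 2 := by
    rw [hg]; dsimp only
    split_ifs with h
    · have : (1 : ℝ) ≤ d := by exact_mod_cast hd1
      rw [h]
      nlinarith
    · positivity
  have hm (r : ℕ) : ∃ X : Matrix (Fin (2 * r + 1)) (Fin (2 * r + 1)) ℂ, IsState X ∧
      ∀ f, mean X f = f 0 := by
    refine ⟨_, isState_single ⟨r, by omega⟩, fun f => ?_⟩
    rw [mean_single]
    congr 1
    simp [mag, spin]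
  have hev : ∀ᶠ r : ℕ in atTop, nmax ≤ 2 * r + 1 :=
    (eventually_ge_atTop nmax).mono fun r hr => by omega
  have key : 0 ≤ ∑ n ∈ Finset.range nmax, Q n * simpleWalk^[n] g 0 := by
    refine ge_of_tendsto (lim g) (hev.mono fun r hr => ?_)
    obtain ⟨X, hX, hXf⟩ := hm r
    have := (E (2 * r)).mean_disturbance (hξ _) (fun n hn => hnmax n hn _) hr X g
    simp only [hXf] at this
    rw [← this]
    exact Finset.sum_nonneg fun i _ =>
      mul_nonneg (((E (2 * r)).isState_disturbance hX).diag_nonneg i) (hg0 _)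
  -- Positivity of the output state turns `g x ≤ x ^ 2` into an inequality of limits:
  -- $Q_d2^{-d}\le\sum_n n\,Q_n$. The left side is nonnegative by `key` and nonzero by the choice of
  -- `d`.
  have key2 : ∑ n ∈ Finset.range nmax, Q n * simpleWalk^[n] g 0 ≤
      ∑ n ∈ Finset.range nmax, Q n * simpleWalk^[n] (fun x => x ^ 2) 0 := by
    refine le_of_tendsto_of_tendsto (lim g) (lim _) (hev.mono fun r hr => ?_)
    obtain ⟨X, hX, hXf⟩ := hm r
    have h1 := (E (2 * r)).mean_disturbance (hξ _) (fun n hn => hnmax n hn _) hr X g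
    have h2 := (E (2 * r)).mean_disturbance (hξ _) (fun n hn => hnmax n hn _) hr X (fun x => x ^ 2)
    simp only [hXf] at h1 h2
    simp only [← h1, ← h2]
    exact ((E (2 * r)).isState_disturbance hX).mean_mono fun i => hgs _
  have e1 : ∑ n ∈ Finset.range nmax, Q n * simpleWalk^[n] g 0 = Q d * (1 / 2) ^ d := by
    rw [Finset.sum_eq_single d]
    · rw [hg, simpleWalk_iterate_of_eq _ _ _ (by ring)]
    · intro n hn hnd
      rcases lt_or_gt_of_ne hnd with h | h
      · rw [hg, simpleWalk_iterate_of_lt _ _ _ (by simpa using h), mul_zero]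
      · by_cases hq0 : Q n = 0
        · rw [hq0, zero_mul]
        · exact absurd (hmax n ⟨hlt n hq0, hq0⟩) (by omega)
    · intro h
      exact absurd (Finset.mem_range.2 hd.1) h
  have e2 : ∑ n ∈ Finset.range nmax, Q n * simpleWalk^[n] (fun x => x ^ 2) 0 =
      ∑ n ∈ Finset.range nmax, n * Q n :=
    Finset.sum_congr rfl fun n _ => by rw [simpleWalk_iterate_sq]; ring
  rw [e1] at key key2
  rw [e2] at key2
  exact lt_of_lt_of_le (lt_of_le_of_ne key (mul_ne_zero hd.2 (by positivity)).symm) key2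

/-! ### Relaxation of the moments -/

/-- The average of `x ^ k` over `[-1, 1]`. -/
def uniformMoment (k : ℕ) : ℝ := if Even k then 1 / ((k : ℝ) + 1) else 0

lemma abs_uniformMoment_le (k : ℕ) : |uniformMoment k| ≤ 1 := by
  unfold uniformMoment
  split_ifs
  · rw [abs_of_nonneg (by positivity), div_le_one (by positivity)]
    have : (0 : ℝ) ≤ k := by positivity
    linarith
  · simp

/-- The uniform law is stationary for the Legendre generator. -/
lemma uniformMoment_recurrence (k : ℕ) :
    1 / 2 * ((k : ℝ) * (k - 1)) * uniformMoment (k - 2) =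
      1 / 2 * (k * (k + 1)) * uniformMoment k := by
  rcases k with _ | _ | k
  · simp
  · simp [uniformMoment]
  · rw [show k + 1 + 1 - 2 = k by omega]
    unfold uniformMoment
    by_cases h : Even k
    · have h2 : Even (k + 1 + 1) := by simpa [Nat.even_add_one] using h
      rw [if_pos h, if_pos h2]
      push_cast
      field_simp
      ring
    · have h2 : ¬ Even (k + 1 + 1) := by simpa [Nat.even_add_one] using h
      rw [if_neg h, if_neg h2]
      ring

/-- A contraction with a small inhomogeneity. -/
lemma le_of_contraction {w : ℕ → ℝ} {α δ : ℝ} (hα1 : α ≤ 1) (t₀ : ℕ)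
    (hw : ∀ t, t₀ ≤ t → w (t + 1) ≤ (1 - α) * w t + α * δ) (s : ℕ) :
    w (t₀ + s) - δ ≤ (1 - α) ^ s * (w t₀ - δ) := by
  induction s with
  | zero => simp
  | succ s ih =>
    have h1 := hw (t₀ + s) (by omega)
    have h2 := mul_le_mul_of_nonneg_left ih (sub_nonneg.2 hα1)
    calc w (t₀ + (s + 1)) - δ ≤ (1 - α) * (w (t₀ + s) - δ) := by
          rw [← add_assoc]
          linarith
      _ ≤ _ := h2.trans (le_of_eq (by ring))

/-- Strong induction in steps of two. Once the $(k-2)$-nd moment has settled, the deviation of the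
$k$-th contracts by a factor $1-\alpha$ per use, with $\alpha$ of order $j^{-2}$ and a forcing small
relative to $\alpha$; another multiple of $j^2$ uses then suffices. For `k = 1` the index `k - 2` is
0 and its coefficient vanishes. -/
lemma exists_relaxation_time {x : ℕ → ℕ → ℕ → ℝ} {j μ : ℕ → ℝ} {M : ℝ}
    (hj : Tendsto j atTop atTop) (hM : 0 < M) (hμ : Tendsto μ atTop (nhds M))
    (hx0 : ∀ N t, x 0 N t = 1) (hx : ∀ k N t, |x k N t| ≤ 1)
    (hstep : ∀ k, ∃ K, 0 ≤ K ∧ ∀ᶠ N in atTop, ∀ t,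
      |x k N (t + 1) - x k N t - μ N * (1 / j N) ^ 2 *
        (1 / 2 * (k * (k - 1)) * x (k - 2) N t - 1 / 2 * (k * (k + 1)) * x k N t)| ≤
        K * (1 / j N) ^ 3)
    (k : ℕ) : ∀ ε > 0, ∃ C > 0, ∀ᶠ N in atTop, ∀ t : ℕ, C * j N ^ 2 ≤ t →
      |x k N t - uniformMoment k| ≤ ε := by
  induction k using Nat.strong_induction_on with
  | _ k ih =>
  intro ε hε
  rcases Nat.eq_zero_or_pos k with rfl | hk
  · refine ⟨1, one_pos, Eventually.of_forall fun N t _ => ?_⟩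
    rw [hx0]
    simp [uniformMoment, hε.le]
  obtain ⟨C₀, hC₀, h₀⟩ := ih (k - 2) (by omega) (ε / 4) (by positivity)
  obtain ⟨K, hK, hs⟩ := hstep k
  have hk1 : (1 : ℝ) ≤ k := by exact_mod_cast hk
  have hrec := uniformMoment_recurrence k
  set γ : ℝ := 1 / 2 * (k * (k + 1)) with hγ
  set β : ℝ := 1 / 2 * ((k : ℝ) * (k - 1)) with hβ
  have hγ1 : 1 ≤ γ := by nlinarith
  have hβ0 : 0 ≤ β := by
    have : (0 : ℝ) ≤ k - 1 := by linarith
    positivity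
  have hβγ : β ≤ γ := by nlinarith
  -- Chosen so that `α * s ≥ 4 / ε` after `C₁ * j N ^ 2` further steps, given `α ≥ M / 2 * h ^ 2`;
  -- then $(1-\alpha)^s\le e^{-4/\varepsilon}\le\varepsilon/4$.
  set C₁ : ℝ := 2 / M * (4 / ε) with hC₁
  have hC₁0 : 0 < C₁ := by positivity
  -- The extra 1 absorbs the rounding of the waiting time `t₀`, as `j N ≥ 1`.
  refine ⟨C₀ + C₁ + 1, by positivity, ?_⟩
  have hjinv : Tendsto (fun N => 1 / j N) atTop (nhds 0) := by
    simp only [one_div]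
    exact hj.inv_tendsto_atTop
  have ev1 : ∀ᶠ N in atTop, 2 * M * γ * (1 / j N) ^ 2 < 1 := by
    have : Tendsto (fun N => 2 * M * γ * (1 / j N) ^ 2) atTop (nhds (2 * M * γ * 0 ^ 2)) :=
      (hjinv.pow 2).const_mul _
    exact this.eventually_lt_const (by norm_num)
  have ev2 : ∀ᶠ N in atTop, K * (1 / j N) < M / 2 * (ε / 4) := by
    have : Tendsto (fun N => K * (1 / j N)) atTop (nhds (K * 0)) := hjinv.const_mul _
    exact this.eventually_lt_const (by rw [mul_zero]; positivity)
  filter_upwards [h₀, hs, ev1, ev2, hj.eventually_ge_atTop 1,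
    hμ.eventually_const_lt (by linarith : M / 2 < M),
    hμ.eventually_lt_const (by linarith : M < 2 * M)] with N h₀ hs ev1 ev2 hj1 hμ1 hμ2 t ht
  have hj0 : 0 < j N := by linarith
  set h := 1 / j N with hh
  have hpos : 0 < h := by positivity
  have hh2 : 0 < h ^ 2 := by positivity
  set α := μ N * h ^ 2 * γ with hα
  have hμ0 : 0 < μ N := by linarith
  have hμh : M / 2 * h ^ 2 ≤ α := by
    calc M / 2 * h ^ 2 ≤ μ N * h ^ 2 := by gcongr
      _ ≤ _ := le_mul_of_one_le_right (by positivity) hγ1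
  have hα0 : 0 ≤ α := by positivity
  have hα1 : α ≤ 1 := by
    calc α = μ N * (h ^ 2 * γ) := by ring
      _ ≤ 2 * M * (h ^ 2 * γ) := by gcongr
      _ ≤ 1 := by linarith
  set t₀ := ⌈C₀ * j N ^ 2⌉₊ with ht₀
  have hw : ∀ t, t₀ ≤ t → |x k N (t + 1) - uniformMoment k| ≤
      (1 - α) * |x k N t - uniformMoment k| + α * (ε / 2) := by
    intro t htt
    have a := h₀ t (Nat.ceil_le.1 htt)
    have b := hs t
    -- Subtracting the stationary recurrence leaves the contracted deviation, the deviation of the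
    -- lower moment and the one-step error. The last two are each at most `α * (ε / 4)`.
    have e : x k N (t + 1) - uniformMoment k = (1 - α) * (x k N t - uniformMoment k) +
        μ N * h ^ 2 * β * (x (k - 2) N t - uniformMoment (k - 2)) +
        (x k N (t + 1) - x k N t -
          μ N * h ^ 2 * (β * x (k - 2) N t - γ * x k N t)) := by
      rw [hα]
      linear_combination (μ N * h ^ 2) * hrec
    rw [e]
    have a' : |μ N * h ^ 2 * β * (x (k - 2) N t - uniformMoment (k - 2))| ≤ α * (ε / 4) := by
      rw [abs_mul, abs_of_nonneg (by positivity : 0 ≤ μ N * h ^ 2 * β)]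
      exact mul_le_mul (by rw [hα]; gcongr) a (abs_nonneg _) hα0
    have b' : K * h ^ 3 ≤ α * (ε / 4) := by
      calc K * h ^ 3 = K * h * h ^ 2 := by ring
        _ ≤ M / 2 * (ε / 4) * h ^ 2 := by gcongr
        _ = M / 2 * h ^ 2 * (ε / 4) := by ring
        _ ≤ _ := by gcongr
    refine (abs_add_three _ _ _).trans ?_
    rw [abs_mul (1 - α), abs_of_nonneg (sub_nonneg.2 hα1)]
    linarith
  have hj2 : 1 ≤ j N ^ 2 := one_le_pow₀ hj1
  have hceil : (t₀ : ℝ) < C₀ * j N ^ 2 + 1 := Nat.ceil_lt_add_one (by positivity)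
  have hs' : (t₀ : ℝ) + C₁ * j N ^ 2 ≤ t := by linarith
  have hle : t₀ ≤ t := by
    have : (t₀ : ℝ) ≤ t := by linarith [mul_nonneg hC₁0.le (sq_nonneg (j N))]
    exact_mod_cast this
  obtain ⟨s, rfl⟩ := Nat.exists_eq_add_of_le hle
  push_cast at hs'
  have hsC : C₁ * j N ^ 2 ≤ s := by linarith
  have main := le_of_contraction (w := fun t => |x k N t - uniformMoment k|) hα1 t₀ hw s
  have hdecay : (1 - α) ^ s ≤ ε / 4 := by
    have h1 : 4 / ε ≤ α * s := by
      calc 4 / ε = M / 2 * h ^ 2 * (C₁ * j N ^ 2) := by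
            rw [hC₁, hh]
            field_simp
        _ ≤ α * s := mul_le_mul hμh hsC (by positivity) hα0
    calc (1 - α) ^ s ≤ Real.exp (-α) ^ s :=
          pow_le_pow_left₀ (sub_nonneg.2 hα1) (Real.one_sub_le_exp_neg α) s
      _ = Real.exp (-(α * s)) := by rw [← Real.exp_nat_mul]; ring_nf
      _ ≤ Real.exp (-(4 / ε)) := Real.exp_le_exp.2 (by linarith)
      _ ≤ (4 / ε)⁻¹ := by
        rw [Real.exp_neg]
        exact inv_anti₀ (by positivity) (by linarith [Real.add_one_le_exp (4 / ε)])
      _ = ε / 4 := by rw [inv_div]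
  have h2 : |x k N t₀ - uniformMoment k| ≤ 2 := by
    refine (abs_sub _ _).trans ?_
    linarith [hx k N t₀, abs_uniformMoment_le k]
  have h3 : (1 - α) ^ s * (|x k N t₀ - uniformMoment k| - ε / 2) ≤ ε / 4 * 2 := by
    calc _ ≤ (1 - α) ^ s * 2 :=
          mul_le_mul_of_nonneg_left (by linarith) (pow_nonneg (sub_nonneg.2 hα1) s)
      _ ≤ _ := by gcongr
  linarith

/-! ### From moments to longevity -/

lemma le_longevity {N : ℕ} {E : JointOperation N} {ρ : Matrix (Fin (N + 1)) (Fin (N + 1)) ℂ}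
    {ℓ : ℕ} {θ B : ℝ} (h : ∀ t : ℕ, moment N ℓ (E.stateAfter ρ t) < θ → B ≤ t) :
    ENNReal.ofReal B ≤ (longevity E ρ ℓ θ : ℝ≥0∞) := by
  have h1 : ((⌈B⌉₊ : ℕ) : ℕ∞) ≤ longevity E ρ ℓ θ :=
    le_iInf₂ fun t ht => by exact_mod_cast Nat.ceil_le.2 (h t ht)
  have h2 : (((⌈B⌉₊ : ℕ) : ℕ∞) : ℝ≥0∞) ≤ (longevity E ρ ℓ θ : ℝ≥0∞) := by exact_mod_cast h1
  refine le_trans ?_ h2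
  rw [ENat.toENNReal_coe, ← ENNReal.ofReal_natCast]
  exact ENNReal.ofReal_le_ofReal (Nat.le_ceil B)

lemma longevity_le {N : ℕ} {E : JointOperation N} {ρ : Matrix (Fin (N + 1)) (Fin (N + 1)) ℂ}
    {ℓ : ℕ} {θ B : ℝ} {t : ℕ} (h : moment N ℓ (E.stateAfter ρ t) < θ) (ht : (t : ℝ) ≤ B) :
    (longevity E ρ ℓ θ : ℝ≥0∞) ≤ ENNReal.ofReal B := by
  have h1 : longevity E ρ ℓ θ ≤ (t : ℕ∞) := iInf₂_le t h
  have h2 : (longevity E ρ ℓ θ : ℝ≥0∞) ≤ ((t : ℕ∞) : ℝ≥0∞) := by exact_mod_cast h1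
  refine h2.trans ?_
  rw [ENat.toENNReal_coe, ← ENNReal.ofReal_natCast]
  exact ENNReal.ofReal_le_ofReal ht

end SpinFrame

end
-- The two bounds
open SpinFrame in
theorem theorem3
    -- for every spin `j = N / 2`: the joint operation and the initial state of the frame
    (E : ∀ N : ℕ, JointOperation N)
    (ρ : ∀ N : ℕ, Matrix (Fin (N + 1)) (Fin (N + 1)) ℂ)
    (hρ : ∀ N, IsState (ρ N))
    -- the disturbance map is `ξ = ∑ₙ qₙ(j) ζ^{∘n}`
    (q : ℕ → ℕ → ℝ)
    (hξ : ∀ N X, (E N).disturbance X =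
      ∑ n ∈ Finset.range (N + 1), ((q n N : ℝ) : ℂ) • (zeta N)^[n] X)
    -- first assumption
    (nmax : ℕ) (hnmax : ∀ n, nmax ≤ n → ∀ N, q n N = 0)
    -- second assumption
    (hq : ∀ n, IsBoundedRational (q n))
    -- third assumption: the initial moment is of the order `j ^ ℓ`
    (ℓ : ℕ) (hℓ : 1 ≤ ℓ) (a : ℝ) (ha : 0 < a)
    (hmom : ∀ᶠ N : ℕ in atTop, a * spin N ^ ℓ ≤ moment N ℓ (ρ N)) :
    -- lower bound
    (∀ c < a, ∃ C > 0, ∀ᶠ N : ℕ in atTop, ∀ θ ≤ c * spin N ^ ℓ,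
      ENNReal.ofReal (C * spin N ^ 2) ≤ (longevity (E N) (ρ N) ℓ θ : ℝ≥0∞)) ∧
    -- upper bound, if the disturbance does not fade away
    ((∃ n, 1 ≤ n ∧ ¬ Tendsto (q n) atTop (nhds 0)) →
      ∀ c > 0, (Even ℓ → 1 / ((ℓ : ℝ) + 1) < c) →
        ∃ C > 0, ∀ᶠ N : ℕ in atTop, ∀ θ ≥ c * spin N ^ ℓ,
          (longevity (E N) (ρ N) ℓ θ : ℝ≥0∞) ≤ ENNReal.ofReal (C * spin N ^ 2)) := by
  choose Q hQ using fun n => (hq n).exists_tendsto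
  set M := ∑ n ∈ Finset.range nmax, n * Q n with hM
  set μ : ℕ → ℝ := fun N => ∑ n ∈ Finset.range nmax, n * q n N with hμd
  have hμ : Tendsto μ atTop (nhds M) := tendsto_finsetSum _ fun n _ => (hQ n).const_mul _
  set x : ℕ → ℕ → ℕ → ℝ := fun k N t => mean ((E N).stateAfter (ρ N) t) (relPow N k) with hxd
  have hst (N t : ℕ) : IsState ((E N).stateAfter (ρ N) t) := (E N).isState_stateAfter (hρ N) t
  have hx (k N t : ℕ) : |x k N t| ≤ 1 :=
    (hst N t).abs_mean_le fun i => abs_relPow_le k (abs_mag_le N i)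
  have hx0 (N t : ℕ) : x 0 N t = 1 := by
    have : relPow N 0 = fun _ => 1 := by ext m; simp [relPow]
    simp only [hxd, this, (hst N t).mean_one]
  set B := ∑ n ∈ Finset.range nmax, (|Q n| + 1) with hB
  have hB0 : 0 ≤ B := Finset.sum_nonneg fun n _ => by positivity
  have hqB : ∀ᶠ N in atTop, ∀ n < nmax, |q n N| ≤ B := by
    have : ∀ᶠ N in atTop, ∀ n ∈ Finset.range nmax, |q n N| < |Q n| + 1 := by
      rw [Filter.eventually_all_finset]
      exact fun n _ => (hQ n).abs.eventually_lt_const (by linarith)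
    filter_upwards [this] with N hN n hn
    exact (hN n (Finset.mem_range.2 hn)).le.trans
      (Finset.single_le_sum (f := fun n => |Q n| + 1) (fun n _ => by positivity)
        (Finset.mem_range.2 hn))
  have hstep (k : ℕ) : ∃ K, 0 ≤ K ∧ ∀ᶠ N in atTop, ∀ t,
      |x k N (t + 1) - x k N t - μ N * (1 / spin N) ^ 2 *
        (1 / 2 * (k * (k - 1)) * x (k - 2) N t - 1 / 2 * (k * (k + 1)) * x k N t)| ≤
        K * (1 / spin N) ^ 3 := by
    obtain ⟨K, hK, hb⟩ := exists_step_bound k nmax B hB0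
    refine ⟨K, hK, ?_⟩
    filter_upwards [hqB, tendsto_spin.eventually_ge_atTop 1, eventually_ge_atTop nmax]
      with N hqN hN hn t
    have := hb (hξ N) (fun n hn => hnmax n hn N) (by omega) hN hqN _ (hst N t)
    rw [← (E N).stateAfter_succ, mean_legendre] at this
    exact this
  constructor
  · intro c hc
    obtain ⟨K, hK, hs⟩ := hstep ℓ
    -- Bounds the loss per use in units of $j^{-2}$: `|M| + 1` dominates `|μ N|` eventually, the
    -- bracket dominates the Legendre term, `K` the error; the final 1 guarantees `L > 0`.
    set L : ℝ := (|M| + 1) * (1 / 2 * (ℓ * (ℓ - 1)) + 1 / 2 * (ℓ * (ℓ + 1))) + K + 1 with hL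
    have hℓ1 : (0 : ℝ) ≤ ℓ - 1 := by
      have : (1 : ℝ) ≤ ℓ := by exact_mod_cast hℓ
      linarith
    have hL0 : 0 < L := by positivity
    refine ⟨(a - c) / L, div_pos (by linarith) hL0, ?_⟩
    filter_upwards [hs, hmom, tendsto_spin.eventually_ge_atTop 1,
      hμ.abs.eventually_lt_const (by linarith : |M| < |M| + 1)] with N hs hmom hN hμN θ hθ
    have hpos : 0 < spin N := by linarith
    have hlip (t : ℕ) : x ℓ N t - L * (1 / spin N) ^ 2 ≤ x ℓ N (t + 1) := by
      have h0 : 0 ≤ 1 / spin N := by positivity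
      have h1 : 1 / spin N ≤ 1 := by rw [div_le_one hpos]; exact hN
      have h32 : (1 / spin N) ^ 3 ≤ (1 / spin N) ^ 2 := pow_le_pow_of_le_one h0 h1 (by norm_num)
      have b := hs t
      set h := 1 / spin N
      have d : |μ N * h ^ 2 * (1 / 2 * (ℓ * (ℓ - 1)) * x (ℓ - 2) N t -
          1 / 2 * (ℓ * (ℓ + 1)) * x ℓ N t)| ≤
          (|M| + 1) * h ^ 2 * (1 / 2 * (ℓ * (ℓ - 1)) + 1 / 2 * (ℓ * (ℓ + 1))) := by
        rw [abs_mul, abs_mul, abs_of_nonneg (by positivity : 0 ≤ h ^ 2)]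
        refine mul_le_mul (by gcongr) ?_ (abs_nonneg _) (by positivity)
        refine (abs_sub _ _).trans (add_le_add ?_ ?_) <;> rw [abs_mul, abs_of_nonneg (by positivity)]
        · exact mul_le_of_le_one_right (by positivity) (hx _ _ _)
        · exact mul_le_of_le_one_right (by positivity) (hx _ _ _)
      have hK32 := mul_le_mul_of_nonneg_left h32 hK
      have e : L * h ^ 2 = (|M| + 1) * h ^ 2 *
          (1 / 2 * (ℓ * (ℓ - 1)) + 1 / 2 * (ℓ * (ℓ + 1))) + K * h ^ 2 + h ^ 2 := by
        rw [hL]; ring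
      have := (abs_le.1 b).1
      have := (abs_le.1 d).1
      linarith [sq_nonneg h]
    have hlow (t : ℕ) : a - t * (L * (1 / spin N) ^ 2) ≤ x ℓ N t := by
      induction t with
      | zero =>
        rw [moment_eq hpos, mul_comm] at hmom
        have : a ≤ mean (ρ N) (relPow N ℓ) := le_of_mul_le_mul_left hmom (by positivity)
        simpa [hxd, JointOperation.stateAfter] using this
      | succ t ih =>
        push_cast
        linarith [hlip t]
    refine le_longevity fun t ht => ?_
    rw [moment_eq hpos] at ht
    have h1 : x ℓ N t < c := by
      have := ht.trans_le hθ
      rw [mul_comm c] at this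
      exact lt_of_mul_lt_mul_left this (by positivity)
    have h2 : a - c ≤ t * (L * (1 / spin N) ^ 2) := by linarith [hlow t]
    rw [div_mul_eq_mul_div, div_le_iff₀ hL0]
    calc (a - c) * spin N ^ 2 ≤ t * (L * (1 / spin N) ^ 2) * spin N ^ 2 := by gcongr
      _ = t * L := by field_simp
  · intro hne c hc hceven
    have hM0 : 0 < M := sum_mul_limit_pos hξ hnmax hQ hne
    -- The parity condition on `c` says exactly that the threshold lies above the stationary moment;
    -- half of the gap is the accuracy requested next.
    have hbc : uniformMoment ℓ < c := by
      unfold uniformMoment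
      split_ifs with h
      · exact hceven h
      · exact hc
    obtain ⟨C, hC, hrel⟩ := exists_relaxation_time tendsto_spin hM0 hμ hx0 hx hstep ℓ
      ((c - uniformMoment ℓ) / 2) (by linarith)
    -- The 1 pays for rounding `C * spin N ^ 2` up to an integer time.
    refine ⟨C + 1, by positivity, ?_⟩
    filter_upwards [hrel, tendsto_spin.eventually_ge_atTop 1] with N hrel hN θ hθ
    have hpos : 0 < spin N := by linarith
    refine longevity_le (t := ⌈C * spin N ^ 2⌉₊) ?_ ?_
    · have h1 := (abs_le.1 (hrel _ (Nat.le_ceil (C * spin N ^ 2)))).2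
      have h2 : x ℓ N ⌈C * spin N ^ 2⌉₊ < c := by linarith
      rw [moment_eq hpos]
      refine lt_of_lt_of_le ?_ hθ
      rw [mul_comm c]
      exact mul_lt_mul_of_pos_left h2 (by positivity)
    · have : (⌈C * spin N ^ 2⌉₊ : ℝ) < C * spin N ^ 2 + 1 := Nat.ceil_lt_add_one (by positivity)
      linarith [one_le_pow₀ hN (n := 2)]
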